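/- Let $M_0$ be a smooth manifold of dimension $n$, and let $M=T^*[2]T[1]M_0$ be the graded manifold with affine coordinates $(q^i,\xi^i,p_i,\theta_i)$, $1\le i\le n$, attached to every local coordinate system $(q^i)$ of $M_0$, where $q^i$ and $p_i$ are even and $\xi^i$ and $\theta_i$ are odd. Over the domain $V$ of such a system a polynomial function on $M$ is an element of $$C^\infty(V)\otimes\mathbb R[p_1,\dots,p_n]\otimes\Lambda(\xi^1,\dots,\xi^n,\theta_1,\dots,\theta_n),$$ and a change of coordinates $q=q(q')$ on $M_0$ induces the change of coordinates $$\xi^{a}=\frac{\partial q^{a}}{\partial q'^{b}}\,\xi'^{b},\qquad \theta_{a}=\frac{\partial q'^{b}}{\partial q^{a}}\,\theta'_{b},\qquad p_{a}=\frac{\partial q'^{b}}{\partial q^{a}}\,p'_{b}+\frac{\partial}{\partial q'^{c}}\Big(\frac{\partial q'^{b}}{\partial q^{a}}\Big)\,\xi'^{c}\theta'_{b}$$ (the cotangent lift to $M$ of the induced change of coordinates on $T[1]M_0$). For integers $k,l$ let $\mathcal A^{k,l}$ be the real vector space of polynomial functions $f$ on $M$ of bidegree $(k,l)$, that is, $\epsilon_1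 f=kf$ and $\epsilon_2 f=lf$ for the Euler vector fields $$\epsilon_1=p_i\frac{\partial}{\partial p_i}+\theta_i\frac{\partial}{\partial\theta_i},\qquad \epsilon_2=p_i\frac{\partial}{\partial p_i}+\xi^i\frac{\partial}{\partial \xi^i}$$ (so $\mathcal A^{k,l}=0$ unless $k,l\ge 0$). Let $$D=\{\Theta_0,\cdot\}=\xi^i\frac{\partial}{\partial q^i}+p_i\frac{\partial}{\partial\theta_i},\qquad \Theta_0=\xi^ip_i,$$ be the de Rham vector field on $M$, where $\{\cdot,\cdot\}$ is the canonical Poisson bracket, normalized by $\{p_i,q^j\}=\delta_i^j=\{\xi^j,\theta_i\}$. It maps $\mathcal A^{k,l}$ to $\mathcal A^{k,l+1}$ and satisfies $D^2=0$. Then for every integer $k>0$ the higher de Rham complex $(\mathcal A^{k,\cdot},D)$ is acyclic: its cohomology vanishes in every degree $l$. -/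

import Mathlib

open scoped TensorProduct Manifold ContDiff
open TopologicalSpace

noncomputable section

namespace HigherDeRham

/-! ### Smooth functions on open subsets of `ℝⁿ` -/

/-- Extension by zero of a function on an open subset of `ℝⁿ`. It is only ever evaluated, or
differentiated, at points of the open subset, so the values outside play no role. -/
def zext {n : ℕ} {V : Opens (EuclideanSpace ℝ (Fin n))} (f : V → ℝ) :
    EuclideanSpace ℝ (Fin n) → ℝ :=
  Function.extend Subtype.val f 0

theorem zext_apply {n : ℕ} {V : Opens (EuclideanSpace ℝ (Fin n))} (f : V → ℝ) (x : V) :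
    zext f x = f x :=
  Subtype.val_injective.extend_apply f 0 x

/-- A function on `ℝⁿ` which restricts to `f` on `V` agrees with `zext f` near the points
of `V`. -/
theorem zext_eventuallyEq {n : ℕ} {V : Opens (EuclideanSpace ℝ (Fin n))} {f : V → ℝ}
    {g : EuclideanSpace ℝ (Fin n) → ℝ} (h : ∀ x : V, f x = g x) (x : V) :
    zext f =ᶠ[nhds (x : EuclideanSpace ℝ (Fin n))] g := by
  filter_upwards [V.isOpen.mem_nhds x.2] with y hy
  rw [← h ⟨y, hy⟩]
  exact zext_apply f ⟨y, hy⟩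

/-- The algebra `C^∞(V)` of smooth real functions on an open subset `V` of `ℝⁿ`. -/
def smoothFun {n : ℕ} (V : Opens (EuclideanSpace ℝ (Fin n))) : Subalgebra ℝ (V → ℝ) where
  carrier := {f | ∀ x : V, ContDiffAt ℝ ∞ (zext f) x}
  mul_mem' {f g} hf hg x :=
    ((hf x).mul (hg x)).congr_of_eventuallyEq
      (zext_eventuallyEq (fun y => by simp [zext_apply]) x)
  add_mem' {f g} hf hg x :=
    ((hf x).add (hg x)).congr_of_eventuallyEq
      (zext_eventuallyEq (fun y => by simp [zext_apply]) x)
  algebraMap_mem' r x :=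
    (contDiffAt_const (c := r)).congr_of_eventuallyEq
      (zext_eventuallyEq (fun y => by simp) x)

/-- A function smooth on the open set `V` of `ℝⁿ`, as an element of `C^∞(V)`. -/
def ofContDiff {n : ℕ} (V : Opens (EuclideanSpace ℝ (Fin n)))
    (g : EuclideanSpace ℝ (Fin n) → ℝ) (hg : ∀ x ∈ V, ContDiffAt ℝ ∞ g x) : smoothFun V :=
  ⟨fun x => g x, fun x =>
    (hg x x.2).congr_of_eventuallyEq (zext_eventuallyEq (fun _ => rfl) x)⟩

/-- The `i`-th partial derivative at `x` of a function on `ℝⁿ`. -/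
def partialAt {n : ℕ} (i : Fin n) (g : EuclideanSpace ℝ (Fin n) → ℝ)
    (x : EuclideanSpace ℝ (Fin n)) : ℝ :=
  fderiv ℝ g x (EuclideanSpace.single i 1)

theorem contDiffAt_partialAt {n : ℕ} (i : Fin n) {g : EuclideanSpace ℝ (Fin n) → ℝ}
    {x : EuclideanSpace ℝ (Fin n)} (hg : ContDiffAt ℝ ∞ g x) :
    ContDiffAt ℝ ∞ (partialAt i g) x :=
  (hg.fderiv_right (m := ∞) (by simp)).clm_apply contDiffAt_const

/-- The partial derivative `∂/∂qⁱ : C^∞(V) → C^∞(V)`. -/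
def partialDeriv {n : ℕ} (V : Opens (EuclideanSpace ℝ (Fin n))) (i : Fin n) :
    smoothFun V →ₗ[ℝ] smoothFun V where
  toFun f := ofContDiff V (partialAt i (zext f.1)) fun x hx =>
    contDiffAt_partialAt i (f.2 ⟨x, hx⟩)
  map_add' f g := by
    ext x
    have h : zext (f + g).1 =ᶠ[nhds (x : EuclideanSpace ℝ (Fin n))] zext f.1 + zext g.1 :=
      zext_eventuallyEq (fun y => by simp [zext_apply]) x
    change fderiv ℝ (zext (f + g).1) x _ = fderiv ℝ (zext f.1) x _ + fderiv ℝ (zext g.1) x _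
    rw [h.fderiv_eq, fderiv_add ((f.2 x).differentiableAt (by simp))
      ((g.2 x).differentiableAt (by simp))]
    rfl
  map_smul' c f := by
    ext x
    have h : zext (c • f).1 =ᶠ[nhds (x : EuclideanSpace ℝ (Fin n))] c • zext f.1 :=
      zext_eventuallyEq (fun y => by simp [zext_apply]) x
    change fderiv ℝ (zext (c • f).1) x _ = c * fderiv ℝ (zext f.1) x _
    rw [h.fderiv_eq, fderiv_const_smul ((f.2 x).differentiableAt (by simp))]
    rfl

/-- Composition `C^∞(V) → C^∞(V')`, `f ↦ f ∘ φ`, with a smooth map `φ : V' → V`. -/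
def compHom {n : ℕ} {V V' : Opens (EuclideanSpace ℝ (Fin n))}
    (φ : EuclideanSpace ℝ (Fin n) → EuclideanSpace ℝ (Fin n))
    (hφ : ∀ y ∈ V', φ y ∈ V ∧ ContDiffAt ℝ ∞ φ y) : smoothFun V →ₐ[ℝ] smoothFun V' where
  toFun f := ofContDiff V' (fun y => zext f.1 (φ y)) fun y hy =>
    (f.2 ⟨φ y, (hφ y hy).1⟩).comp y (hφ y hy).2
  map_one' := by
    ext y; exact zext_apply (1 : smoothFun V).1 ⟨φ y, (hφ y y.2).1⟩
  map_mul' f g := by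
    ext y
    have h (f : smoothFun V) := zext_apply f.1 ⟨φ y, (hφ y y.2).1⟩
    change zext _ _ = zext _ _ * zext _ _
    rw [h f, h g]; exact h (f * g)
  map_zero' := by
    ext y; exact zext_apply (0 : smoothFun V).1 ⟨φ y, (hφ y y.2).1⟩
  map_add' f g := by
    ext y
    have h (f : smoothFun V) := zext_apply f.1 ⟨φ y, (hφ y y.2).1⟩
    change zext _ _ = zext _ _ + zext _ _
    rw [h f, h g]; exact h (f + g)
  commutes' r := by
    ext y; exact zext_apply (algebraMap ℝ (smoothFun V) r).1 ⟨φ y, (hφ y y.2).1⟩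

/-! ### Polynomial functions on `T*[2]T[1]V` for an open subset `V` of `ℝⁿ` -/

/-- The algebra `C^∞(V) ⊗ ℝ[p₁, …, pₙ] ⊗ Λ(ξ¹, …, ξⁿ, θ₁, …, θₙ)` of polynomial functions on
`T*[2]T[1]V`. The `p`'s are even; the `ξ`'s (indexed by `Sum.inl`) and the `θ`'s (indexed by
`Sum.inr`) are odd. -/
def Loc {n : ℕ} (V : Opens (EuclideanSpace ℝ (Fin n))) : Type :=
  smoothFun V ⊗[ℝ] (MvPolynomial (Fin n) ℝ ⊗[ℝ] ExteriorAlgebra ℝ (Fin n ⊕ Fin n → ℝ))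

instance {n : ℕ} (V : Opens (EuclideanSpace ℝ (Fin n))) : Ring (Loc V) :=
  inferInstanceAs (Ring (smoothFun V ⊗[ℝ]
    (MvPolynomial (Fin n) ℝ ⊗[ℝ] ExteriorAlgebra ℝ (Fin n ⊕ Fin n → ℝ))))

instance {n : ℕ} (V : Opens (EuclideanSpace ℝ (Fin n))) : Algebra ℝ (Loc V) :=
  inferInstanceAs (Algebra ℝ (smoothFun V ⊗[ℝ]
    (MvPolynomial (Fin n) ℝ ⊗[ℝ] ExteriorAlgebra ℝ (Fin n ⊕ Fin n → ℝ))))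

/-- The product `f(q) u(p) w(ξ, θ)`. -/
def mon {n : ℕ} {V : Opens (EuclideanSpace ℝ (Fin n))} (f : smoothFun V)
    (u : MvPolynomial (Fin n) ℝ) (w : ExteriorAlgebra ℝ (Fin n ⊕ Fin n → ℝ)) : Loc V :=
  f ⊗ₜ[ℝ] (u ⊗ₜ[ℝ] w)

@[elab_as_elim]
theorem Loc.induction {n : ℕ} {V : Opens (EuclideanSpace ℝ (Fin n))} {P : Loc V → Prop}
    (hadd : ∀ x y, P x → P y → P (x + y)) (hmon : ∀ f u w, P (mon f u w)) (x : Loc V) : P x := by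
  have h0 : P 0 := by
    have h := hmon 0 0 0
    rwa [show mon (V := V) 0 0 0 = 0 from TensorProduct.zero_tmul _ _] at h
  induction x using TensorProduct.induction_on with
  | zero => exact h0
  | add x y hx hy => exact hadd x y hx hy
  | tmul f w =>
    induction w using TensorProduct.induction_on with
    | zero => rw [TensorProduct.tmul_zero]; exact h0
    | add x y hx hy => rw [TensorProduct.tmul_add]; exact hadd _ _ hx hy
    | tmul u w => exact hmon f u w

theorem mon_mul_mon {n : ℕ} {V : Opens (EuclideanSpace ℝ (Fin n))} (f g : smoothFun V)
    (u v : MvPolynomial (Fin n) ℝ) (w z : ExteriorAlgebra ℝ (Fin n ⊕ Fin n → ℝ)) :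
    mon f u w * mon g v z = mon (f * g) (u * v) (w * z) :=
  (Algebra.TensorProduct.tmul_mul_tmul f g (u ⊗ₜ[ℝ] w) (v ⊗ₜ[ℝ] z)).trans
    (congrArg (TensorProduct.tmul ℝ (f * g)) (Algebra.TensorProduct.tmul_mul_tmul u v w z))

section Loc

variable {n : ℕ} (V : Opens (EuclideanSpace ℝ (Fin n)))

theorem mon_neg (f : smoothFun V) (u : MvPolynomial (Fin n) ℝ)
    (w : ExteriorAlgebra ℝ (Fin n ⊕ Fin n → ℝ)) : mon f u (-w) = -mon f u w :=
  (congrArg (TensorProduct.tmul ℝ f) (TensorProduct.tmul_neg u w)).trans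
    (TensorProduct.tmul_neg f (u ⊗ₜ[ℝ] w))

/-- A smooth function of the `q`'s, as a function on `T*[2]T[1]V`. -/
def fn (f : smoothFun V) : Loc V := mon f 1 1

/-- The even coordinate `pᵢ`. -/
def p (i : Fin n) : Loc V := mon 1 (MvPolynomial.X i) 1

/-- The odd coordinate `ξⁱ`. -/
def ξ (i : Fin n) : Loc V := mon 1 1 (ExteriorAlgebra.ι ℝ (Pi.single (Sum.inl i) 1))

/-- The odd coordinate `θᵢ`. -/
def θ (i : Fin n) : Loc V := mon 1 1 (ExteriorAlgebra.ι ℝ (Pi.single (Sum.inr i) 1))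

/-- The vector field `∂/∂qⁱ`. -/
def dq (i : Fin n) : Loc V →ₗ[ℝ] Loc V := (partialDeriv V i).rTensor _

/-- The vector field `∂/∂pᵢ`. -/
def dp (i : Fin n) : Loc V →ₗ[ℝ] Loc V :=
  LinearMap.lTensor _ (LinearMap.rTensor _ (MvPolynomial.pderiv i).toLinearMap)

/-- The (odd, left) vector field `∂/∂ξⁱ`. -/
def dξ (i : Fin n) : Loc V →ₗ[ℝ] Loc V :=
  LinearMap.lTensor _ (LinearMap.lTensor _
    (CliffordAlgebra.contractLeft (LinearMap.proj (Sum.inl i))))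

/-- The (odd, left) vector field `∂/∂θᵢ`. -/
def dθ (i : Fin n) : Loc V →ₗ[ℝ] Loc V :=
  LinearMap.lTensor _ (LinearMap.lTensor _
    (CliffordAlgebra.contractLeft (LinearMap.proj (Sum.inr i))))

/-- The first Euler vector field `ε₁ = pᵢ ∂/∂pᵢ + θᵢ ∂/∂θᵢ`. -/
def euler₁ : Loc V →ₗ[ℝ] Loc V :=
  ∑ i, (LinearMap.mulLeft ℝ (p V i) ∘ₗ dp V i + LinearMap.mulLeft ℝ (θ V i) ∘ₗ dθ V i)

/-- The second Euler vector field `ε₂ = pᵢ ∂/∂pᵢ + ξⁱ ∂/∂ξⁱ`. -/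
def euler₂ : Loc V →ₗ[ℝ] Loc V :=
  ∑ i, (LinearMap.mulLeft ℝ (p V i) ∘ₗ dp V i + LinearMap.mulLeft ℝ (ξ V i) ∘ₗ dξ V i)

/-- The parity involution: `F ↦ (-1)^|F| F`. -/
def parity : Loc V →ₗ[ℝ] Loc V :=
  LinearMap.lTensor _ (LinearMap.lTensor _
    (CliffordAlgebra.involute (Q := (0 : QuadraticForm ℝ (Fin n ⊕ Fin n → ℝ)))).toLinearMap)

/-- The even Poisson bracket (of degree `-2`) of the canonical symplectic structure in the
Darboux coordinates `(q, ξ, p, θ)`, normalized by `{pᵢ, qʲ} = δᵢʲ = {ξʲ, θᵢ}`. The right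
derivatives in the odd directions are `F ↦ (-1)^(|F| - 1) ∂F`. -/
def poissonBracket (F G : Loc V) : Loc V :=
  ∑ i, (dp V i F * dq V i G - dq V i F * dp V i G
    + parity V (dξ V i F) * dθ V i G + parity V (dθ V i F) * dξ V i G)

/-- The cubic Hamiltonian `Θ₀ = ξⁱ pᵢ`. -/
def Θ₀ : Loc V := ∑ i, ξ V i * p V i

/-- The de Rham vector field `D = ξⁱ ∂/∂qⁱ + pᵢ ∂/∂θᵢ`. -/
def deRham : Loc V →ₗ[ℝ] Loc V :=
  ∑ i, (LinearMap.mulLeft ℝ (ξ V i) ∘ₗ dq V i + LinearMap.mulLeft ℝ (p V i) ∘ₗ dθ V i)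

end Loc

theorem exterior_even_central {ι : Type*} (a b : ι → ℝ) (z : ExteriorAlgebra ℝ (ι → ℝ)) :
    z * (ExteriorAlgebra.ι ℝ a * ExteriorAlgebra.ι ℝ b)
      = ExteriorAlgebra.ι ℝ a * ExteriorAlgebra.ι ℝ b * z := by
  have anti (u v : ι → ℝ) : ExteriorAlgebra.ι ℝ u * ExteriorAlgebra.ι ℝ v
      = -(ExteriorAlgebra.ι ℝ v * ExteriorAlgebra.ι ℝ u) :=
    eq_neg_of_add_eq_zero_left (ExteriorAlgebra.ι_add_mul_swap u v)
  induction z using ExteriorAlgebra.induction with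
  | algebraMap r => exact Algebra.commutes r _
  | ι c =>
    rw [← mul_assoc, anti c a, neg_mul, mul_assoc, anti c b, mul_neg, neg_neg, mul_assoc]
  | mul x y hx hy => rw [mul_assoc, hy, ← mul_assoc, hx, mul_assoc]
  | add x y hx hy => rw [add_mul, mul_add, hx, hy]

section Loc

variable {n : ℕ} (V : Opens (EuclideanSpace ℝ (Fin n)))

theorem fn_mem_center (f : smoothFun V) : fn V f ∈ Subalgebra.center ℝ (Loc V) := by
  rw [Subalgebra.mem_center_iff]
  intro z
  induction z using Loc.induction with
  | hadd x y hx hy => rw [add_mul, mul_add, hx, hy]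
  | hmon g u w => simp [fn, mon_mul_mon, mul_comm]

theorem p_mem_center (i : Fin n) : p V i ∈ Subalgebra.center ℝ (Loc V) := by
  rw [Subalgebra.mem_center_iff]
  intro z
  induction z using Loc.induction with
  | hadd x y hx hy => rw [add_mul, mul_add, hx, hy]
  | hmon g u w => simp [p, mon_mul_mon, mul_comm]

theorem ξ_mul_θ_mem_center (i j : Fin n) : ξ V i * θ V j ∈ Subalgebra.center ℝ (Loc V) := by
  rw [Subalgebra.mem_center_iff]
  intro z
  induction z using Loc.induction with
  | hadd x y hx hy => rw [add_mul, mul_add, hx, hy]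
  | hmon g u w => simp [ξ, θ, mon_mul_mon, exterior_even_central]

/-- The space of functions of the form `∑ fᵢ(q) ξⁱ + ∑ gⁱ(q) θᵢ`. -/
def oddLinear : Submodule ℝ (Loc V) :=
  Submodule.span ℝ (Set.range fun fj : smoothFun V × (Fin n ⊕ Fin n) =>
    mon fj.1 1 (ExteriorAlgebra.ι ℝ (Pi.single fj.2 1)))

theorem fn_mul_ξ_mem (f : smoothFun V) (i : Fin n) : fn V f * ξ V i ∈ oddLinear V :=
  Submodule.subset_span ⟨(f, Sum.inl i), by simp [fn, ξ, mon_mul_mon]⟩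

theorem fn_mul_θ_mem (f : smoothFun V) (i : Fin n) : fn V f * θ V i ∈ oddLinear V :=
  Submodule.subset_span ⟨(f, Sum.inr i), by simp [fn, θ, mon_mul_mon]⟩

theorem mul_self_of_mem_oddLinear {x : Loc V} (hx : x ∈ oddLinear V) : x * x = 0 := by
  have anti : ∀ y ∈ oddLinear V, x * y = -(y * x) := by
    intro y hy
    induction hx, hy using Submodule.span_induction₂ with
    | mem_mem x y hx hy =>
      obtain ⟨⟨f, i⟩, rfl⟩ := hx
      obtain ⟨⟨g, j⟩, rfl⟩ := hy
      have h := eq_neg_of_add_eq_zero_left (ExteriorAlgebra.ι_add_mul_swap (R := ℝ)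
        (Pi.single i 1 : Fin n ⊕ Fin n → ℝ) (Pi.single j 1))
      rw [mon_mul_mon, mon_mul_mon, h, mul_comm g f, mon_neg]
    | zero_left y hy => rw [zero_mul, mul_zero, neg_zero]
    | zero_right x hx => rw [zero_mul, mul_zero, neg_zero]
    | add_left x y z _ _ _ h1 h2 => rw [add_mul, mul_add, h1, h2, neg_add]
    | add_right x y z _ _ _ h1 h2 => rw [add_mul, mul_add, h1, h2, neg_add]
    | smul_left r x y _ _ h => rw [smul_mul_assoc, mul_smul_comm, h, smul_neg]
    | smul_right r x y _ _ h => rw [smul_mul_assoc, mul_smul_comm, h, smul_neg]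
  have h : (2 : ℝ) • (x * x) = 0 := by
    rw [two_smul]
    exact eq_neg_iff_add_eq_zero.mp (anti x hx)
  exact (smul_eq_zero.mp h).resolve_left two_ne_zero

variable {V}

/-- Substitution of coordinates: the algebra homomorphism `Loc V → Loc V'` which is `c` on the
functions of the `q`'s, and maps `ξⁱ ↦ Ξ i`, `θᵢ ↦ Θ i`, `pᵢ ↦ P i`. -/
def subst {V' : Opens (EuclideanSpace ℝ (Fin n))} (c : smoothFun V →ₐ[ℝ] smoothFun V')
    (Ξ Θ : Fin n → oddLinear V') (P : Fin n → Subalgebra.center ℝ (Loc V')) :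
    Loc V →ₐ[ℝ] Loc V' :=
  Algebra.TensorProduct.lift
    ((Algebra.TensorProduct.includeLeft : smoothFun V' →ₐ[ℝ] Loc V').comp c)
    (Algebra.TensorProduct.lift
      ((Subalgebra.center ℝ (Loc V')).val.comp (MvPolynomial.aeval P))
      (ExteriorAlgebra.lift ℝ
        ⟨(oddLinear V').subtype ∘ₗ Fintype.linearCombination ℝ (Sum.elim Ξ Θ),
          fun _ => mul_self_of_mem_oddLinear V' (Subtype.prop _)⟩)
      fun u _ => (Subalgebra.mem_center_iff.mp (MvPolynomial.aeval P u).2 _).symm)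
    fun f _ => (Subalgebra.mem_center_iff.mp (fn_mem_center V' (c f)) _).symm

section subst

variable {V' : Opens (EuclideanSpace ℝ (Fin n))} (c : smoothFun V →ₐ[ℝ] smoothFun V')
  (Ξ Θ : Fin n → oddLinear V') (P : Fin n → Subalgebra.center ℝ (Loc V'))

theorem subst_mon (f : smoothFun V) (u : MvPolynomial (Fin n) ℝ)
    (w : ExteriorAlgebra ℝ (Fin n ⊕ Fin n → ℝ)) :
    subst c Ξ Θ P (mon f u w) = fn V' (c f) * ((MvPolynomial.aeval P u).1 *
      ExteriorAlgebra.lift ℝ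
        ⟨(oddLinear V').subtype ∘ₗ Fintype.linearCombination ℝ (Sum.elim Ξ Θ),
          fun _ => mul_self_of_mem_oddLinear V' (Subtype.prop _)⟩ w) :=
  rfl

theorem subst_fn (f : smoothFun V) : subst c Ξ Θ P (fn V f) = fn V' (c f) := by
  simp [fn, subst_mon]

theorem fn_one : fn V 1 = 1 := rfl

theorem subst_p (i : Fin n) : subst c Ξ Θ P (p V i) = P i := by
  simp [p, subst_mon, fn_one]

theorem subst_ξ (i : Fin n) : subst c Ξ Θ P (ξ V i) = Ξ i := by
  simp [ξ, subst_mon, fn_one]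

theorem subst_θ (i : Fin n) : subst c Ξ Θ P (θ V i) = Θ i := by
  simp [θ, subst_mon, fn_one]

end subst

end Loc

/-! ### Polynomial functions on `T*[2]T[1]M` for a smooth manifold `M` -/

section Manifold

variable {n : ℕ} {M : Type*} [TopologicalSpace M] [ChartedSpace (EuclideanSpace ℝ (Fin n)) M]

variable (n M) in
/-- The local coordinate systems `x = (x¹, …, xⁿ)` of the smooth manifold `M`: all the charts of
its maximal smooth atlas. -/
abbrev Chart : Type _ :=
  {e : OpenPartialHomeomorph M (EuclideanSpace ℝ (Fin n)) //
    e ∈ IsManifold.maximalAtlas (𝓡 n) ∞ M}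

/-- The image `e(dom e)` of a chart. -/
def Chart.target (e : Chart n M) : Opens (EuclideanSpace ℝ (Fin n)) :=
  ⟨e.1.target, e.1.open_target⟩

/-- The set `e'(dom e ∩ dom e')`: the common domain of the two charts, in the coordinates
of `e'`. -/
def overlap (e e' : Chart n M) : Opens (EuclideanSpace ℝ (Fin n)) :=
  ⟨(e'.1.symm.trans e.1).source, (e'.1.symm.trans e.1).open_source⟩

/-- The coordinates of `e` as functions of those of `e'`: the map `e ∘ e'⁻¹`. -/
def changeMap (e e' : Chart n M) : EuclideanSpace ℝ (Fin n) → EuclideanSpace ℝ (Fin n) :=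
  fun y => e.1 (e'.1.symm y)

theorem changeMap_contDiffAt [IsManifold (𝓡 n) ∞ M] (e e' : Chart n M)
    {y : EuclideanSpace ℝ (Fin n)} (hy : y ∈ overlap e e') :
    ContDiffAt ℝ ∞ (changeMap e e') y := by
  have h := (mem_groupoid_of_pregroupoid.mp
    (IsManifold.compatible_of_mem_maximalAtlas e'.2 e.2)).1
  have h2 : ContDiffOn ℝ ∞ (changeMap e e') (overlap e e') :=
    ContDiffOn.mono h fun y hy => ⟨hy, by simp⟩
  exact h2.contDiffAt ((overlap e e').isOpen.mem_nhds hy)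

theorem changeMap_mem_target (e e' : Chart n M) {y : EuclideanSpace ℝ (Fin n)}
    (hy : y ∈ overlap e e') : changeMap e e' y ∈ e.target :=
  e.1.map_source hy.2

theorem changeMap_mem_overlap (e e' : Chart n M) {y : EuclideanSpace ℝ (Fin n)}
    (hy : y ∈ overlap e e') : changeMap e e' y ∈ overlap e' e := by
  refine ⟨changeMap_mem_target e e' hy, ?_⟩
  have h : e'.1.symm y ∈ e.1.source := hy.2
  change e.1.symm (e.1 (e'.1.symm y)) ∈ e'.1.source
  rw [e.1.left_inv h]
  exact e'.1.map_target hy.1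

/-- The `a`-th coordinate of `e`, as a smooth function of the coordinates of `e'`. -/
def coordFun [IsManifold (𝓡 n) ∞ M] (e e' : Chart n M) (a : Fin n) : smoothFun (overlap e e') :=
  ofContDiff _ (fun y => changeMap e e' y a) fun _ hy =>
    (contDiffAt_euclidean.mp (changeMap_contDiffAt e e' hy)) a

/-- The Jacobian `∂xᵃ/∂yᵇ` of the change of coordinates, as a function of `y`, where `x` are the
coordinates of `e` and `y` those of `e'`. -/
def jac [IsManifold (𝓡 n) ∞ M] (e e' : Chart n M) (a b : Fin n) : smoothFun (overlap e e') :=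
  partialDeriv _ b (coordFun e e' a)

/-- The inverse Jacobian `∂yᵇ/∂xᵃ` of the change of coordinates, as a function of `y`, where `x`
are the coordinates of `e` and `y` those of `e'`. -/
def invJac [IsManifold (𝓡 n) ∞ M] (e e' : Chart n M) (b a : Fin n) : smoothFun (overlap e e') :=
  compHom (changeMap e e')
    (fun _ hy => ⟨changeMap_mem_overlap e e' hy, changeMap_contDiffAt e e' hy⟩) (jac e' e b a)

/-- The change of coordinates on `T*[2]T[1]M` induced by a change of coordinates on `M` from `y`
(the coordinates of `e'`) to `x` (those of `e`): it sends the coordinates `(x, ξ, p, θ)` belonging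
to `e` to
`ξᵃ ↦ (∂xᵃ/∂yᵇ) ξᵇ`, `θₐ ↦ (∂yᵇ/∂xᵃ) θ_b`,
`pₐ ↦ (∂yᵇ/∂xᵃ) p_b + ∂/∂yᶜ (∂yᵇ/∂xᵃ) ξᶜ θ_b`,
where `(y, ξ, p, θ)` on the right are those belonging to `e'`. This is the cotangent lift of the
transformation `(y, ξ) ↦ (x, ξ)` of `T[1]M`: the only transformation law of the `p`'s and `θ`'s,
of bidegree `(1, 1)` and `(1, 0)`, that preserves the canonical Poisson bracket. -/
def changeCoord [IsManifold (𝓡 n) ∞ M] (e e' : Chart n M) : Loc e.target →ₐ[ℝ] Loc (overlap e e') :=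
  subst
    (compHom (changeMap e e')
      fun _ hy => ⟨changeMap_mem_target e e' hy, changeMap_contDiffAt e e' hy⟩)
    (fun a => ∑ b, ⟨fn _ (jac e e' a b) * ξ _ b, fn_mul_ξ_mem _ _ _⟩)
    (fun a => ∑ b, ⟨fn _ (invJac e e' b a) * θ _ b, fn_mul_θ_mem _ _ _⟩)
    (fun a =>
      ∑ b, ⟨fn _ (invJac e e' b a), fn_mem_center _ _⟩ * ⟨p _ b, p_mem_center _ _⟩
        + ∑ b, ∑ c, ⟨fn _ (partialDeriv _ c (invJac e e' b a)), fn_mem_center _ _⟩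
            * ⟨ξ _ c * θ _ b, ξ_mul_θ_mem_center _ _ _⟩)

/-- Restriction of a function on `T*[2]T[1]M`, expressed in the coordinates of `e'`, to the common
domain with `e`. -/
def restrict (e e' : Chart n M) : Loc e'.target →ₐ[ℝ] Loc (overlap e e') :=
  subst (compHom id fun _ hy => ⟨hy.1, contDiffAt_id⟩)
    (fun a => ⟨ξ _ a, by simpa [fn_one] using fn_mul_ξ_mem (overlap e e') 1 a⟩)
    (fun a => ⟨θ _ a, by simpa [fn_one] using fn_mul_θ_mem (overlap e e') 1 a⟩)
    (fun a => ⟨p _ a, p_mem_center _ a⟩)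

variable (n M) in
/-- The space `A^{k,l}` of polynomial functions of bidegree `(k, l)` on `T*[2]T[1]M`. Such a
function is given by its expressions in all the local coordinate systems of `M`, which are related
by the changes of coordinates, and which satisfy `ε₁ f = k f` and `ε₂ f = l f`. -/
def bidegree [IsManifold (𝓡 n) ∞ M] (k l : ℤ) : Submodule ℝ (∀ e : Chart n M, Loc e.target) where
  carrier := {f | (∀ e e', changeCoord e e' (f e) = restrict e e' (f e')) ∧
    ∀ e, euler₁ _ (f e) = (k : ℝ) • f e ∧ euler₂ _ (f e) = (l : ℝ) • f e}
  zero_mem' := by simp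
  add_mem' {f g} hf hg := by
    refine ⟨fun e e' => ?_, fun e => ⟨?_, ?_⟩⟩
    · simp [hf.1 e e', hg.1 e e']
    · simp [(hf.2 e).1, (hg.2 e).1]
    · simp [(hf.2 e).2, (hg.2 e).2]
  smul_mem' r f hf := by
    refine ⟨fun e e' => ?_, fun e => ⟨?_, ?_⟩⟩
    · simp [hf.1 e e']
    · simp [(hf.2 e).1, smul_comm r]
    · simp [(hf.2 e).2, smul_comm r]

end Manifold

/-! ### Derivation rules -/

section Leibniz

variable {n : ℕ} {V : Opens (EuclideanSpace ℝ (Fin n))}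

theorem mon_add_left (f g : smoothFun V) (u : MvPolynomial (Fin n) ℝ)
    (w : ExteriorAlgebra ℝ (Fin n ⊕ Fin n → ℝ)) : mon (f + g) u w = mon f u w + mon g u w :=
  TensorProduct.add_tmul _ _ _

theorem mon_add_mid (f : smoothFun V) (u v : MvPolynomial (Fin n) ℝ)
    (w : ExteriorAlgebra ℝ (Fin n ⊕ Fin n → ℝ)) : mon f (u + v) w = mon f u w + mon f v w :=
  (congrArg (TensorProduct.tmul ℝ f) (TensorProduct.add_tmul u v w)).trans
    (TensorProduct.tmul_add _ _ _)

theorem mon_add_right (f : smoothFun V) (u : MvPolynomial (Fin n) ℝ)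
    (w z : ExteriorAlgebra ℝ (Fin n ⊕ Fin n → ℝ)) : mon f u (w + z) = mon f u w + mon f u z :=
  (congrArg (TensorProduct.tmul ℝ f) (TensorProduct.tmul_add u w z)).trans
    (TensorProduct.tmul_add _ _ _)

theorem dq_mon (i : Fin n) (f : smoothFun V) (u : MvPolynomial (Fin n) ℝ)
    (w : ExteriorAlgebra ℝ (Fin n ⊕ Fin n → ℝ)) :
    dq V i (mon f u w) = mon (partialDeriv V i f) u w := rfl

theorem dp_mon (i : Fin n) (f : smoothFun V) (u : MvPolynomial (Fin n) ℝ)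
    (w : ExteriorAlgebra ℝ (Fin n ⊕ Fin n → ℝ)) :
    dp V i (mon f u w) = mon f (MvPolynomial.pderiv i u) w := rfl

theorem dξ_mon (i : Fin n) (f : smoothFun V) (u : MvPolynomial (Fin n) ℝ)
    (w : ExteriorAlgebra ℝ (Fin n ⊕ Fin n → ℝ)) :
    dξ V i (mon f u w)
      = mon f u (CliffordAlgebra.contractLeft (LinearMap.proj (Sum.inl i)) w) := rfl

theorem dθ_mon (i : Fin n) (f : smoothFun V) (u : MvPolynomial (Fin n) ℝ)
    (w : ExteriorAlgebra ℝ (Fin n ⊕ Fin n → ℝ)) :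
    dθ V i (mon f u w)
      = mon f u (CliffordAlgebra.contractLeft (LinearMap.proj (Sum.inr i)) w) := rfl

theorem parity_mon (f : smoothFun V) (u : MvPolynomial (Fin n) ℝ)
    (w : ExteriorAlgebra ℝ (Fin n ⊕ Fin n → ℝ)) :
    parity V (mon f u w) = mon f u (CliffordAlgebra.involute w) := rfl

theorem parity_mul (x y : Loc V) : parity V (x * y) = parity V x * parity V y := by
  induction x using Loc.induction with
  | hadd x x' h h' => simp [add_mul, h, h']
  | hmon f u w =>
    induction y using Loc.induction with
    | hadd x x' h h' => simp [mul_add, h, h']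
    | hmon g v z => simp only [mon_mul_mon, parity_mon]; rw [map_mul]

theorem partialDeriv_mul (i : Fin n) (f g : smoothFun V) :
    partialDeriv V i (f * g) = partialDeriv V i f * g + f * partialDeriv V i g := by
  ext x
  have h : zext (f * g).1 =ᶠ[nhds (x : EuclideanSpace ℝ (Fin n))] zext f.1 * zext g.1 :=
    zext_eventuallyEq (fun y => by simp [zext_apply]) x
  change fderiv ℝ (zext (f * g).1) x _ = fderiv ℝ (zext f.1) x _ * _ + _ * fderiv ℝ (zext g.1) x _
  rw [h.fderiv_eq, fderiv_mul ((f.2 x).differentiableAt (by simp))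
    ((g.2 x).differentiableAt (by simp))]
  simp [zext_apply]
  ring

theorem dq_mul (i : Fin n) (x y : Loc V) : dq V i (x * y) = dq V i x * y + x * dq V i y := by
  induction x using Loc.induction with
  | hadd x x' h h' => simp only [add_mul, h, h', map_add]; abel
  | hmon f u w =>
    induction y using Loc.induction with
    | hadd x x' h h' => simp only [mul_add, h, h', map_add]; abel
    | hmon g v z => simp only [mon_mul_mon, dq_mon, partialDeriv_mul, mon_add_left]

theorem contractLeft_mul (d : Module.Dual ℝ (Fin n ⊕ Fin n → ℝ))
    (w z : ExteriorAlgebra ℝ (Fin n ⊕ Fin n → ℝ)) :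
    CliffordAlgebra.contractLeft d (w * z) = CliffordAlgebra.contractLeft d w * z
      + CliffordAlgebra.involute w * CliffordAlgebra.contractLeft d z := by
  induction w using CliffordAlgebra.left_induction with
  | algebraMap r =>
    rw [CliffordAlgebra.contractLeft_algebraMap_mul]; simp
  | add x y hx hy => simp only [add_mul, map_add, hx, hy]; abel
  | ι_mul x m hx =>
    rw [mul_assoc, CliffordAlgebra.contractLeft_ι_mul, hx, CliffordAlgebra.contractLeft_ι_mul]
    simp only [map_mul, CliffordAlgebra.involute_ι, sub_mul, mul_add, smul_mul_assoc, neg_mul,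
      mul_assoc]
    abel

theorem dθ_mul (i : Fin n) (x y : Loc V) :
    dθ V i (x * y) = dθ V i x * y + parity V x * dθ V i y := by
  induction x using Loc.induction with
  | hadd x x' h h' => simp only [add_mul, h, h', map_add]; abel
  | hmon f u w =>
    induction y using Loc.induction with
    | hadd x x' h h' => simp only [mul_add, h, h', map_add]; abel
    | hmon g v z =>
      simp only [mon_mul_mon, dθ_mon, parity_mon]
      rw [contractLeft_mul, mon_add_right]

theorem ι_mul_comm (a : Fin n ⊕ Fin n → ℝ) (w : ExteriorAlgebra ℝ (Fin n ⊕ Fin n → ℝ)) :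
    ExteriorAlgebra.ι ℝ a * w = CliffordAlgebra.involute w * ExteriorAlgebra.ι ℝ a := by
  induction w using ExteriorAlgebra.induction with
  | algebraMap r => rw [AlgHom.commutes]; exact (Algebra.commutes r _).symm
  | ι c =>
    rw [eq_neg_of_add_eq_zero_left (ExteriorAlgebra.ι_add_mul_swap a c)]
    rw [← neg_mul]; congr 1; exact (CliffordAlgebra.involute_ι c).symm
  | mul x y hx hy => rw [← mul_assoc, hx, mul_assoc, hy, ← mul_assoc, map_mul]
  | add x y hx hy => rw [map_add, add_mul, mul_add, hx, hy]

theorem ξ_mul_comm (i : Fin n) (x : Loc V) : ξ V i * x = parity V x * ξ V i := by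
  induction x using Loc.induction with
  | hadd x x' h h' => simp only [mul_add, h, h', map_add, add_mul]
  | hmon f u w =>
    simp only [ξ, mon_mul_mon, parity_mon, one_mul, mul_one]
    rw [ι_mul_comm]

theorem θ_mul_comm (i : Fin n) (x : Loc V) : θ V i * x = parity V x * θ V i := by
  induction x using Loc.induction with
  | hadd x x' h h' => simp only [mul_add, h, h', map_add, add_mul]
  | hmon f u w =>
    simp only [θ, mon_mul_mon, parity_mon, one_mul, mul_one]
    rw [ι_mul_comm]

theorem p_mul_comm (i : Fin n) (x : Loc V) : p V i * x = x * p V i :=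
  (Subalgebra.mem_center_iff.mp (p_mem_center V i) x).symm

theorem fn_mul_comm (f : smoothFun V) (x : Loc V) : fn V f * x = x * fn V f :=
  (Subalgebra.mem_center_iff.mp (fn_mem_center V f) x).symm

theorem deRham_apply (x : Loc V) :
    deRham V x = ∑ i, (ξ V i * dq V i x + p V i * dθ V i x) := by
  simp [deRham, LinearMap.sum_apply]

theorem deRham_mul (x y : Loc V) :
    deRham V (x * y) = deRham V x * y + parity V x * deRham V y := by
  simp only [deRham_apply, Finset.sum_mul, Finset.mul_sum, ← Finset.sum_add_distrib]
  refine Finset.sum_congr rfl fun i _ => ?_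
  rw [dq_mul, dθ_mul]
  simp only [mul_add, add_mul, mul_assoc]
  rw [← mul_assoc (ξ V i) x, ξ_mul_comm i x, ← mul_assoc (p V i) (parity V x), p_mul_comm i (parity V x)]
  simp only [mul_assoc]
  abel

theorem dq_fn (i : Fin n) (f : smoothFun V) : dq V i (fn V f) = fn V (partialDeriv V i f) := rfl

theorem partialDeriv_one (i : Fin n) : partialDeriv V i 1 = 0 := by
  have h := partialDeriv_mul (V := V) i 1 1
  simpa using h

theorem mon_zero_left (u : MvPolynomial (Fin n) ℝ)
    (w : ExteriorAlgebra ℝ (Fin n ⊕ Fin n → ℝ)) : mon (0 : smoothFun V) u w = 0 :=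
  TensorProduct.zero_tmul _ _

theorem mon_zero_right (f : smoothFun V) (u : MvPolynomial (Fin n) ℝ) : mon f u 0 = 0 :=
  (congrArg (TensorProduct.tmul ℝ f) (TensorProduct.tmul_zero _ u)).trans
    (TensorProduct.tmul_zero _ _)

theorem mon_zero_mid (f : smoothFun V) (w : ExteriorAlgebra ℝ (Fin n ⊕ Fin n → ℝ)) :
    mon f 0 w = 0 :=
  (congrArg (TensorProduct.tmul ℝ f) (TensorProduct.zero_tmul _ w)).trans
    (TensorProduct.tmul_zero _ _)

theorem mon_one : (mon 1 1 1 : Loc V) = 1 := rfl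

theorem dθ_fn (i : Fin n) (f : smoothFun V) : dθ V i (fn V f) = 0 := by
  rw [fn, dθ_mon, CliffordAlgebra.contractLeft_one, mon_zero_right]
theorem dq_p (i j : Fin n) : dq V i (p V j) = 0 := by
  rw [p, dq_mon, partialDeriv_one, mon_zero_left]
theorem dθ_p (i j : Fin n) : dθ V i (p V j) = 0 := by
  rw [p, dθ_mon, CliffordAlgebra.contractLeft_one, mon_zero_right]
theorem dq_ξ (i j : Fin n) : dq V i (ξ V j) = 0 := by
  rw [ξ, dq_mon, partialDeriv_one, mon_zero_left]
theorem dq_θ (i j : Fin n) : dq V i (θ V j) = 0 := by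
  rw [θ, dq_mon, partialDeriv_one, mon_zero_left]
theorem dθ_ξ (i j : Fin n) : dθ V i (ξ V j) = 0 := by
  rw [ξ, dθ_mon]
  erw [CliffordAlgebra.contractLeft_ι]
  simp [mon_zero_right]
theorem dθ_θ (i j : Fin n) : dθ V i (θ V j) = if i = j then 1 else 0 := by
  rw [θ, dθ_mon]
  erw [CliffordAlgebra.contractLeft_ι]
  split_ifs with h
  · simp [h, mon_one]
  · simp [h, mon_zero_right]

theorem deRham_fn (f : smoothFun V) :
    deRham V (fn V f) = ∑ i, ξ V i * fn V (partialDeriv V i f) := by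
  simp [deRham_apply, dq_fn, dθ_fn]
theorem deRham_p (i : Fin n) : deRham V (p V i) = 0 := by
  simp [deRham_apply, dq_p, dθ_p]
theorem deRham_ξ (i : Fin n) : deRham V (ξ V i) = 0 := by
  simp [deRham_apply, dq_ξ, dθ_ξ]
theorem deRham_θ (i : Fin n) : deRham V (θ V i) = p V i := by
  simp [deRham_apply, dq_θ, dθ_θ]

theorem parity_fn (f : smoothFun V) : parity V (fn V f) = fn V f := by
  rw [fn, parity_mon, map_one]
theorem parity_p (i : Fin n) : parity V (p V i) = p V i := by
  rw [p, parity_mon, map_one]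
theorem parity_ξ (i : Fin n) : parity V (ξ V i) = - ξ V i := by
  rw [ξ, parity_mon]; erw [CliffordAlgebra.involute_ι]; rw [mon_neg]
theorem parity_θ (i : Fin n) : parity V (θ V i) = - θ V i := by
  rw [θ, parity_mon]; erw [CliffordAlgebra.involute_ι]; rw [mon_neg]

theorem mon_smul (r : ℝ) (f : smoothFun V) (u : MvPolynomial (Fin n) ℝ)
    (w : ExteriorAlgebra ℝ (Fin n ⊕ Fin n → ℝ)) : mon (r • f) u w = r • mon f u w :=
  (TensorProduct.smul_tmul' _ _ _).symm

theorem fn_algebraMap (r : ℝ) : fn V (algebraMap ℝ _ r) = algebraMap ℝ (Loc V) r := rfl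

/-- The functions of the `q`'s and the coordinates `p`, `ξ`, `θ` generate `Loc V`. -/
theorem Loc.gen_induction {P : Loc V → Prop} (hadd : ∀ x y, P x → P y → P (x + y))
    (hmul : ∀ x y, P x → P y → P (x * y)) (hfn : ∀ f, P (fn V f)) (hp : ∀ i, P (p V i))
    (hξ : ∀ i, P (ξ V i)) (hθ : ∀ i, P (θ V i)) (x : Loc V) : P x := by
  induction x using Loc.induction with
  | hadd x y hx hy => exact hadd x y hx hy
  | hmon f u w =>
    have e : mon f u w = fn V f * (mon 1 u 1 * mon 1 1 w) := by
      simp [fn, mon_mul_mon]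
    rw [e]
    clear e
    refine hmul _ _ (hfn f) (hmul _ _ ?_ ?_)
    · induction u using MvPolynomial.induction_on with
      | C r =>
        have : mon 1 (MvPolynomial.C r) 1 = fn V (algebraMap ℝ _ r) := by
          rw [fn_algebraMap]
          have : (MvPolynomial.C r : MvPolynomial (Fin n) ℝ) = r • 1 := by
            rw [MvPolynomial.smul_eq_C_mul, mul_one]
          rw [this, Algebra.algebraMap_eq_smul_one, ← mon_one, ← mon_smul]
          exact (congrArg (TensorProduct.tmul ℝ _)
            (TensorProduct.smul_tmul' r (1 : MvPolynomial (Fin n) ℝ) _).symm).trans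
            ((TensorProduct.tmul_smul r _ _).trans (TensorProduct.smul_tmul' _ _ _))
        rw [this]; exact hfn _
      | add u v hu hv => rw [mon_add_mid]; exact hadd _ _ hu hv
      | mul_X u i h =>
        rw [show mon 1 (u * MvPolynomial.X i) 1 = mon 1 u 1 * p V i by simp [p, mon_mul_mon]]
        exact hmul _ _ h (hp i)
    · have hr (r : ℝ) : (mon 1 1 (algebraMap ℝ _ r) : Loc V) = fn V (algebraMap ℝ _ r) := by
          rw [fn_algebraMap, Algebra.algebraMap_eq_smul_one, Algebra.algebraMap_eq_smul_one,
            ← mon_one]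
          exact (congrArg (TensorProduct.tmul ℝ _)
            (TensorProduct.tmul_smul r _ _)).trans (TensorProduct.tmul_smul r _ _)
      induction w using ExteriorAlgebra.induction with
      | algebraMap r => rw [hr]; exact hfn _
      | ι c =>
        have : (mon 1 1 (ExteriorAlgebra.ι ℝ c) : Loc V)
            = ∑ i, fn V (algebraMap ℝ _ (c (Sum.inl i))) * ξ V i
              + ∑ i, fn V (algebraMap ℝ _ (c (Sum.inr i))) * θ V i := by
          simp only [← hr, ξ, θ, mon_mul_mon, one_mul, ← Algebra.smul_def, ← map_smul]
          let L : (Fin n ⊕ Fin n → ℝ) →ₗ[ℝ] Loc V :=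
            { toFun := fun c => mon 1 1 (ExteriorAlgebra.ι ℝ c)
              map_add' := fun a b => by rw [map_add, mon_add_right]
              map_smul' := fun r a => by
                rw [map_smul]
                exact (congrArg (TensorProduct.tmul ℝ _)
                  (TensorProduct.tmul_smul r _ _)).trans (TensorProduct.tmul_smul r _ _) }
          change L c = ∑ i, L _ + ∑ i, L _
          rw [← map_sum, ← map_sum, ← map_add]
          congr 1
          ext (i | i) <;> simp [Pi.single_apply]
        rw [this]
        have h0 : P 0 := by
          have := hfn (algebraMap ℝ _ 0); rwa [fn_algebraMap, map_zero] at this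
        refine hadd _ _ ?_ ?_ <;> refine Finset.sum_induction _ P hadd h0 fun i _ => hmul _ _ (hfn _) ?_
        · exact hξ i
        · exact hθ i
      | mul x y hx hy =>
        rw [show (mon 1 1 (x * y) : Loc V) = mon 1 1 x * mon 1 1 y by simp [mon_mul_mon]]
        exact hmul _ _ hx hy
      | add x y hx hy =>
        rw [mon_add_right]
        exact hadd _ _ hx hy

theorem partialDeriv_comm (i j : Fin n) (f : smoothFun V) :
    partialDeriv V i (partialDeriv V j f) = partialDeriv V j (partialDeriv V i f) := by
  ext x
  have key (i j : Fin n) : (partialDeriv V i (partialDeriv V j f)).1 x =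
      fderiv ℝ (fderiv ℝ (zext f.1)) x (EuclideanSpace.single i 1) (EuclideanSpace.single j 1) := by
    have h : zext (partialDeriv V j f).1 =ᶠ[nhds (x : EuclideanSpace ℝ (Fin n))]
        partialAt j (zext f.1) := zext_eventuallyEq (g := partialAt j (zext f.1)) (fun y => rfl) x
    change fderiv ℝ (zext (partialDeriv V j f).1) x _ = _
    rw [h.fderiv_eq]
    have hd : DifferentiableAt ℝ (fderiv ℝ (zext f.1)) x :=
      ((f.2 x).fderiv_right (m := ∞) (by simp)).differentiableAt (by simp)
    change fderiv ℝ (fun y => fderiv ℝ (zext f.1) y (EuclideanSpace.single j 1)) x _ = _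
    rw [fderiv_clm_apply hd (by fun_prop)]
    simp
  rw [key, key]
  exact ((f.2 x).isSymmSndFDerivAt (by simpa using (WithTop.coe_le_coe.2 le_top : ((2 : ℕ∞) : WithTop ℕ∞) ≤ ∞))).eq _ _

theorem deRham_deRham_fn (f : smoothFun V) : deRham V (deRham V (fn V f)) = 0 := by
  simp only [deRham_fn, map_sum, deRham_mul, deRham_ξ, zero_mul, zero_add, parity_ξ, neg_mul,
    Finset.sum_neg_distrib, neg_eq_zero, Finset.mul_sum]
  set S := ∑ i, ∑ j, ξ V i * (ξ V j * fn V (partialDeriv V j (partialDeriv V i f))) with hS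
  have h : S = -S := by
    conv_lhs => rw [hS, Finset.sum_comm]
    rw [hS, ← Finset.sum_neg_distrib]
    refine Finset.sum_congr rfl fun i _ => ?_
    rw [← Finset.sum_neg_distrib]
    refine Finset.sum_congr rfl fun j _ => ?_
    rw [← mul_assoc, ξ_mul_comm j, parity_ξ, partialDeriv_comm, neg_mul, neg_mul, mul_assoc]
  have h2 : (2 : ℝ) • S = 0 := by
    rw [two_smul]
    exact eq_neg_iff_add_eq_zero.mp h
  exact (smul_eq_zero.mp h2).resolve_left two_ne_zero

theorem parity_deRham (x : Loc V) : parity V (deRham V x) = - deRham V (parity V x) := by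
  induction x using Loc.gen_induction with
  | hadd x y hx hy => simp [hx, hy, add_comm]
  | hmul x y hx hy =>
    simp only [deRham_mul, parity_mul, map_add, hx, hy]
    simp [add_comm]
  | hfn f => simp [deRham_fn, parity_fn, parity_mul, parity_ξ]
  | hp i => simp [deRham_p, parity_p]
  | hξ i => simp [deRham_ξ, parity_ξ]
  | hθ i => simp [deRham_θ, parity_p, parity_θ]

theorem deRham_deRham (x : Loc V) : deRham V (deRham V x) = 0 := by
  induction x using Loc.gen_induction with
  | hadd x y hx hy => simp [hx, hy]
  | hmul x y hx hy => simp [deRham_mul, hx, hy, parity_deRham]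
  | hfn f => exact deRham_deRham_fn f
  | hp i => simp [deRham_p]
  | hξ i => simp [deRham_ξ]
  | hθ i => simp [deRham_θ, deRham_p]

theorem dξ_fn (i : Fin n) (f : smoothFun V) : dξ V i (fn V f) = 0 := by
  rw [fn, dξ_mon, CliffordAlgebra.contractLeft_one, mon_zero_right]

/-- `D` is the Hamiltonian vector field `{Θ₀, ·}`. -/
theorem deRham_eq_poissonBracket (x : Loc V) : deRham V x = poissonBracket V (Θ₀ V) x := by
  have h (j : Fin n) : ξ V j * p V j = mon 1 (MvPolynomial.X j) (ExteriorAlgebra.ι ℝ (Pi.single (Sum.inl j) 1)) := by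
    simp [ξ, p, mon_mul_mon]
  have h1 (i : Fin n) : dp V i (Θ₀ V) = ξ V i := by
    simp only [Θ₀, map_sum, h, dp_mon, MvPolynomial.pderiv_X]
    rw [Finset.sum_eq_single i]
    · simp [ξ]
    · intro j _ hj; simp [mon_zero_mid, hj]
    · simp
  have h2 (i : Fin n) : dq V i (Θ₀ V) = 0 := by
    simp [Θ₀, h, dq_mon, partialDeriv_one, mon_zero_left]
  have h3 (i : Fin n) : dξ V i (Θ₀ V) = p V i := by
    simp only [Θ₀, map_sum, h, dξ_mon]
    rw [Finset.sum_eq_single i]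
    · erw [CliffordAlgebra.contractLeft_ι]; simp [p]
    · intro j _ hj; erw [CliffordAlgebra.contractLeft_ι]; simp [hj.symm, mon_zero_right]
    · simp
  have h4 (i : Fin n) : dθ V i (Θ₀ V) = 0 := by
    simp only [Θ₀, map_sum, h, dθ_mon]
    refine Finset.sum_eq_zero fun j _ => ?_
    erw [CliffordAlgebra.contractLeft_ι]; simp [mon_zero_right]
  simp [deRham_apply, poissonBracket, h1, h2, h3, h4, parity_p]

end Leibniz

section Leibniz

variable {n : ℕ} {V : Opens (EuclideanSpace ℝ (Fin n))}

theorem dp_mul (i : Fin n) (x y : Loc V) : dp V i (x * y) = dp V i x * y + x * dp V i y := by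
  induction x using Loc.induction with
  | hadd x x' h h' => simp only [add_mul, h, h', map_add]; abel
  | hmon f u w =>
    induction y using Loc.induction with
    | hadd x x' h h' => simp only [mul_add, h, h', map_add]; abel
    | hmon g v z =>
      simp only [mon_mul_mon, dp_mon]
      rw [Derivation.leibniz, smul_eq_mul, smul_eq_mul, mul_comm v, add_comm, mon_add_mid]

theorem dξ_mul (i : Fin n) (x y : Loc V) :
    dξ V i (x * y) = dξ V i x * y + parity V x * dξ V i y := by
  induction x using Loc.induction with
  | hadd x x' h h' => simp only [add_mul, h, h', map_add]; abel
  | hmon f u w =>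
    induction y using Loc.induction with
    | hadd x x' h h' => simp only [mul_add, h, h', map_add]; abel
    | hmon g v z =>
      simp only [mon_mul_mon, dξ_mon, parity_mon]
      rw [contractLeft_mul, mon_add_right]

theorem euler₁_apply (x : Loc V) :
    euler₁ V x = ∑ i, (p V i * dp V i x + θ V i * dθ V i x) := by
  simp [euler₁, LinearMap.sum_apply]

theorem euler₂_apply (x : Loc V) :
    euler₂ V x = ∑ i, (p V i * dp V i x + ξ V i * dξ V i x) := by
  simp [euler₂, LinearMap.sum_apply]

theorem parity_parity (x : Loc V) : parity V (parity V x) = x := by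
  induction x using Loc.induction with
  | hadd x x' h h' => simp only [map_add, h, h']
  | hmon f u w => rw [parity_mon, parity_mon, CliffordAlgebra.involute_involute]

theorem euler₁_mul (x y : Loc V) : euler₁ V (x * y) = euler₁ V x * y + x * euler₁ V y := by
  simp only [euler₁_apply, Finset.sum_mul, Finset.mul_sum, ← Finset.sum_add_distrib]
  refine Finset.sum_congr rfl fun i _ => ?_
  rw [dp_mul, dθ_mul]
  simp only [mul_add, add_mul, ← mul_assoc]
  rw [p_mul_comm i x, θ_mul_comm i (parity V x), parity_parity]
  abel

theorem euler₂_mul (x y : Loc V) : euler₂ V (x * y) = euler₂ V x * y + x * euler₂ V y := by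
  simp only [euler₂_apply, Finset.sum_mul, Finset.mul_sum, ← Finset.sum_add_distrib]
  refine Finset.sum_congr rfl fun i _ => ?_
  rw [dp_mul, dξ_mul]
  simp only [mul_add, add_mul, ← mul_assoc]
  rw [p_mul_comm i x, ξ_mul_comm i (parity V x), parity_parity]
  abel

theorem dp_fn (i : Fin n) (f : smoothFun V) : dp V i (fn V f) = 0 := by
  rw [fn, dp_mon, Derivation.map_one_eq_zero, mon_zero_mid]
theorem dp_p (i j : Fin n) : dp V i (p V j) = if i = j then 1 else 0 := by
  rw [p, dp_mon, MvPolynomial.pderiv_X]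
  split_ifs with h
  · simp [h, mon_one]
  · simp [Ne.symm h, mon_zero_mid]
theorem dp_ξ (i j : Fin n) : dp V i (ξ V j) = 0 := by
  rw [ξ, dp_mon, Derivation.map_one_eq_zero, mon_zero_mid]
theorem dp_θ (i j : Fin n) : dp V i (θ V j) = 0 := by
  rw [θ, dp_mon, Derivation.map_one_eq_zero, mon_zero_mid]
theorem dξ_p (i j : Fin n) : dξ V i (p V j) = 0 := by
  rw [p, dξ_mon, CliffordAlgebra.contractLeft_one, mon_zero_right]
theorem dξ_θ (i j : Fin n) : dξ V i (θ V j) = 0 := by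
  rw [θ, dξ_mon]
  erw [CliffordAlgebra.contractLeft_ι]
  simp [mon_zero_right]
theorem dξ_ξ (i j : Fin n) : dξ V i (ξ V j) = if i = j then 1 else 0 := by
  rw [ξ, dξ_mon]
  erw [CliffordAlgebra.contractLeft_ι]
  split_ifs with h
  · simp [h, mon_one]
  · simp [h, mon_zero_right]

theorem euler₁_fn (f : smoothFun V) : euler₁ V (fn V f) = 0 := by
  simp [euler₁_apply, dp_fn, dθ_fn]
theorem euler₁_p (i : Fin n) : euler₁ V (p V i) = p V i := by
  simp [euler₁_apply, dp_p, dθ_p]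
theorem euler₁_ξ (i : Fin n) : euler₁ V (ξ V i) = 0 := by
  simp [euler₁_apply, dp_ξ, dθ_ξ]
theorem euler₁_θ (i : Fin n) : euler₁ V (θ V i) = θ V i := by
  simp [euler₁_apply, dp_θ, dθ_θ]
theorem euler₂_fn (f : smoothFun V) : euler₂ V (fn V f) = 0 := by
  simp [euler₂_apply, dp_fn, dξ_fn]
theorem euler₂_p (i : Fin n) : euler₂ V (p V i) = p V i := by
  simp [euler₂_apply, dp_p, dξ_p]
theorem euler₂_ξ (i : Fin n) : euler₂ V (ξ V i) = ξ V i := by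
  simp [euler₂_apply, dp_ξ, dξ_ξ]
theorem euler₂_θ (i : Fin n) : euler₂ V (θ V i) = 0 := by
  simp [euler₂_apply, dp_θ, dξ_θ]

theorem parity_euler₁ (x : Loc V) : parity V (euler₁ V x) = euler₁ V (parity V x) := by
  induction x using Loc.gen_induction with
  | hadd x y hx hy => simp [hx, hy]
  | hmul x y hx hy => simp [euler₁_mul, parity_mul, hx, hy]
  | hfn f => simp [euler₁_fn, parity_fn]
  | hp i => simp [euler₁_p, parity_p]
  | hξ i => simp [euler₁_ξ, parity_ξ]
  | hθ i => simp [euler₁_θ, parity_θ]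

theorem parity_euler₂ (x : Loc V) : parity V (euler₂ V x) = euler₂ V (parity V x) := by
  induction x using Loc.gen_induction with
  | hadd x y hx hy => simp [hx, hy]
  | hmul x y hx hy => simp [euler₂_mul, parity_mul, hx, hy]
  | hfn f => simp [euler₂_fn, parity_fn]
  | hp i => simp [euler₂_p, parity_p]
  | hξ i => simp [euler₂_ξ, parity_ξ]
  | hθ i => simp [euler₂_θ, parity_θ]

theorem euler₁_deRham (x : Loc V) : euler₁ V (deRham V x) = deRham V (euler₁ V x) := by
  induction x using Loc.gen_induction with
  | hadd x y hx hy => simp [hx, hy]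
  | hmul x y hx hy =>
    simp only [deRham_mul, euler₁_mul, map_add, hx, hy, parity_euler₁]; abel
  | hfn f => simp [deRham_fn, euler₁_fn, euler₁_mul, euler₁_ξ]
  | hp i => simp [euler₁_p, deRham_p]
  | hξ i => simp [euler₁_ξ, deRham_ξ]
  | hθ i => simp [euler₁_θ, deRham_θ, euler₁_p]

theorem euler₂_deRham (x : Loc V) :
    euler₂ V (deRham V x) = deRham V (euler₂ V x) + deRham V x := by
  induction x using Loc.gen_induction with
  | hadd x y hx hy => simp only [map_add, hx, hy]; abel
  | hmul x y hx hy =>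
    simp only [deRham_mul, euler₂_mul, map_add, hx, hy, parity_euler₂, add_mul, mul_add]; abel
  | hfn f => simp [deRham_fn, euler₂_fn, euler₂_mul, euler₂_ξ]
  | hp i => simp [euler₂_p, deRham_p]
  | hξ i => simp [euler₂_ξ, deRham_ξ]
  | hθ i => simp [euler₂_θ, deRham_θ, euler₂_p]

section subst
variable {V' : Opens (EuclideanSpace ℝ (Fin n))} (c : smoothFun V →ₐ[ℝ] smoothFun V')
  (Ξ Θ : Fin n → oddLinear V') (P : Fin n → Subalgebra.center ℝ (Loc V'))

theorem parity_oddLinear (x : oddLinear V') : parity V' x = -x := by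
  obtain ⟨x, hx⟩ := x
  induction hx using Submodule.span_induction with
  | mem x h =>
    obtain ⟨⟨f, j⟩, rfl⟩ := h
    simp only [parity_mon]
    erw [CliffordAlgebra.involute_ι]
    rw [mon_neg]
  | zero => simp
  | add x y hx hy h h' =>
    simp only [map_add] at *; rw [h, h']; abel
  | smul r x hx h =>
    simp only [map_smul] at *; rw [h]; simp

theorem parity_subst (hP : ∀ i, parity V' (P i) = P i) (x : Loc V) :
    subst c Ξ Θ P (parity V x) = parity V' (subst c Ξ Θ P x) := by
  induction x using Loc.gen_induction with
  | hadd x y hx hy => simp [hx, hy]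
  | hmul x y hx hy => simp [parity_mul, hx, hy]
  | hfn f => simp [parity_fn, subst_fn]
  | hp i => simp [parity_p, subst_p, hP]
  | hξ i => simp [parity_ξ, subst_ξ, parity_oddLinear]
  | hθ i => simp [parity_θ, subst_θ, parity_oddLinear]

theorem subst_deRham
    (hc : ∀ f, ∑ i, (Ξ i : Loc V') * fn V' (c (partialDeriv V i f)) = deRham V' (fn V' (c f)))
    (hΞ : ∀ i, deRham V' (Ξ i) = 0) (hΘ : ∀ i, deRham V' (Θ i) = P i) (x : Loc V) :
    subst c Ξ Θ P (deRham V x) = deRham V' (subst c Ξ Θ P x) := by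
  have hP (i) : parity V' (P i) = P i := by
    rw [← hΘ, parity_deRham, parity_oddLinear, map_neg, neg_neg]
  induction x using Loc.gen_induction with
  | hadd x y hx hy => simp [hx, hy]
  | hmul x y hx hy => simp [deRham_mul, hx, hy, parity_subst c Ξ Θ P hP]
  | hfn f => simp [deRham_fn f, subst_fn, subst_ξ, hc]
  | hp i => simp [deRham_p, subst_p, ← hΘ, deRham_deRham]
  | hξ i => simp [deRham_ξ, subst_ξ, hΞ]
  | hθ i => simp [deRham_θ, subst_θ, subst_p, hΘ]

end subst

/-- The chain rule. -/
theorem partialDeriv_compHom {V' : Opens (EuclideanSpace ℝ (Fin n))}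
    (φ : EuclideanSpace ℝ (Fin n) → EuclideanSpace ℝ (Fin n))
    (hφ : ∀ y ∈ V', φ y ∈ V ∧ ContDiffAt ℝ ∞ φ y) (b : Fin n) (f : smoothFun V) :
    partialDeriv V' b (compHom φ hφ f) = ∑ a, compHom φ hφ (partialDeriv V a f) *
      partialDeriv V' b (ofContDiff V' (fun y => φ y a)
        fun y hy => contDiffAt_euclidean.mp (hφ y hy).2 a) := by
  ext y
  have hd : DifferentiableAt ℝ φ y := (hφ y y.2).2.differentiableAt (by simp)
  have hf : DifferentiableAt ℝ (zext f.1) (φ y) :=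
    (f.2 ⟨φ y, (hφ y y.2).1⟩).differentiableAt (by simp)
  have h1 : zext (compHom φ hφ f).1 =ᶠ[nhds (y : EuclideanSpace ℝ (Fin n))]
      fun y => zext f.1 (φ y) := zext_eventuallyEq (g := fun y => zext f.1 (φ y)) (fun y => rfl) y
  have h2 (a) : zext (ofContDiff V' (fun y => φ y a)
        fun y hy => contDiffAt_euclidean.mp (hφ y hy).2 a).1
      =ᶠ[nhds (y : EuclideanSpace ℝ (Fin n))] fun y => φ y a :=
    zext_eventuallyEq (g := fun y => φ y a) (fun y => rfl) y
  have h3 (a) : (partialDeriv V' b (ofContDiff V' (fun y => φ y a)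
        fun y hy => contDiffAt_euclidean.mp (hφ y hy).2 a)).1 y
      = fderiv ℝ φ y (EuclideanSpace.single b 1) a := by
    change fderiv ℝ (zext _) _ _ = _
    rw [(h2 a).fderiv_eq]
    have := ((EuclideanSpace.proj (𝕜 := ℝ) a).hasFDerivAt.comp (y : EuclideanSpace ℝ (Fin n)) hd.hasFDerivAt).fderiv
    change fderiv ℝ ((EuclideanSpace.proj (𝕜 := ℝ) a) ∘ φ) _ _ = _
    rw [this]; rfl
  have h4 (a) : (compHom φ hφ (partialDeriv V a f)).1 y = fderiv ℝ (zext f.1) (φ y) (EuclideanSpace.single a 1) :=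
    zext_apply (partialDeriv V a f).1 ⟨φ y, (hφ y y.2).1⟩
  have h5 : (partialDeriv V' b (compHom φ hφ f)).1 y
      = fderiv ℝ (zext f.1) (φ y) (fderiv ℝ φ y (EuclideanSpace.single b 1)) := by
    change fderiv ℝ (zext _) _ _ = _
    rw [h1.fderiv_eq]
    change fderiv ℝ (zext f.1 ∘ φ) _ _ = _
    rw [fderiv_comp _ hf hd]; rfl
  rw [h5]
  rw [AddSubmonoidClass.coe_finsetSum, Finset.sum_apply]
  simp only [Subalgebra.coe_mul, Pi.mul_apply, h3, h4]
  generalize fderiv ℝ φ y (EuclideanSpace.single b 1) = v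
  conv_lhs => rw [show v = ∑ a, v a • EuclideanSpace.single a (1 : ℝ) by
    ext j; simp [Pi.single_apply]]
  simp [mul_comm]

end Leibniz

theorem fn_mul {n : ℕ} {V : Opens (EuclideanSpace ℝ (Fin n))} (f g : smoothFun V) :
    fn V (f * g) = fn V f * fn V g := by
  simp [fn, mon_mul_mon]

theorem fn_sum {n : ℕ} {V : Opens (EuclideanSpace ℝ (Fin n))} {ι : Type*} (s : Finset ι)
    (f : ι → smoothFun V) : fn V (∑ i ∈ s, f i) = ∑ i ∈ s, fn V (f i) :=
  map_sum (Algebra.TensorProduct.includeLeft : smoothFun V →ₐ[ℝ] Loc V) f s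

section Manifold
variable {n : ℕ} {M : Type*} [TopologicalSpace M] [ChartedSpace (EuclideanSpace ℝ (Fin n)) M]

theorem restrict_deRham (e e' : Chart n M) (x : Loc e'.target) :
    restrict e e' (deRham _ x) = deRham _ (restrict e e' x) := by
  refine subst_deRham _ _ _ _ (fun f => ?_) (fun a => deRham_ξ a) (fun a => deRham_θ a) x
  rw [deRham_fn]
  refine Finset.sum_congr rfl fun b _ => ?_
  have h (a : Fin n) (h) : partialDeriv (overlap e e') b (ofContDiff _ (fun y => id y a) h)
      = if a = b then 1 else 0 := by
    ext y
    have h2 : zext (ofContDiff (overlap e e') (fun y => id y a) h).1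
        =ᶠ[nhds (y : EuclideanSpace ℝ (Fin n))] EuclideanSpace.proj (𝕜 := ℝ) a :=
      zext_eventuallyEq (g := EuclideanSpace.proj (𝕜 := ℝ) a) (fun y => rfl) y
    change fderiv ℝ (zext _) _ _ = _
    rw [h2.fderiv_eq, ContinuousLinearMap.fderiv]
    split_ifs with hab <;> simp [hab]
  rw [partialDeriv_compHom]
  simp only [h, mul_ite, mul_one, mul_zero, Finset.sum_ite_eq', Finset.mem_univ, if_true]

variable [IsManifold (𝓡 n) ∞ M]

theorem changeCoord_deRham (e e' : Chart n M) (x : Loc e.target) :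
    changeCoord e e' (deRham _ x) = deRham _ (changeCoord e e' x) := by
  refine subst_deRham _ _ _ _ (fun f => ?_) (fun a => ?_) (fun a => ?_) x
  · rw [deRham_fn]
    simp only [AddSubmonoidClass.coe_finsetSum, Finset.sum_mul]
    rw [Finset.sum_comm]
    refine Finset.sum_congr rfl fun b _ => ?_
    rw [partialDeriv_compHom, fn_sum, Finset.mul_sum]
    refine Finset.sum_congr rfl fun a _ => ?_
    rw [fn_mul_comm, mul_assoc, fn_mul, fn_mul_comm (jac e e' a b)]
    rfl
  · have key : ∑ b, fn _ (jac e e' a b) * ξ _ b = deRham _ (fn _ (coordFun e e' a)) := by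
      simp only [deRham_fn, fn_mul_comm]; rfl
    rw [AddSubmonoidClass.coe_finsetSum, key, deRham_deRham]
  · simp only [AddSubmonoidClass.coe_finsetSum, map_sum, deRham_mul, deRham_θ, deRham_fn,
      parity_fn, Finset.sum_add_distrib, Finset.sum_mul]
    rw [add_comm]
    simp [← fn_mul_comm, mul_assoc]

variable (n M) in
/-- The de Rham differential `D : A^{k,l} → A^{k,l+1}`: the vector field `D` in all the local
coordinate systems. -/
def deRhamD (k l : ℤ) : bidegree n M k l →ₗ[ℝ] bidegree n M k (l + 1) where
  toFun f := ⟨fun e => deRham _ (f.1 e), by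
    refine ⟨fun e e' => ?_, fun e => ⟨?_, ?_⟩⟩
    · rw [changeCoord_deRham, restrict_deRham, f.2.1 e e']
    · rw [euler₁_deRham, (f.2.2 e).1, map_smul]
    · rw [euler₂_deRham, (f.2.2 e).2, map_smul]
      push_cast
      rw [add_smul, one_smul]⟩
  map_add' f g := by ext e; simp
  map_smul' r f := by ext e; simp

variable (n M) in
/-- The complex `(A^{k,·}, D)`: the de Rham complex of `M` for `k = 0`, and a higher de Rham
complex for `k > 0`. (As there are no functions of negative weight, `A^{k,l} = 0` for `l < 0`.) -/
def higherDeRhamComplex (k : ℤ) : CochainComplex (ModuleCat ℝ) ℤ :=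
  CochainComplex.of (fun l => ModuleCat.of ℝ (bidegree n M k l))
    (fun l => ModuleCat.ofHom (deRhamD n M k l)) fun _ =>
      ModuleCat.hom_ext (LinearMap.ext fun _ => Subtype.ext (funext fun _ => deRham_deRham _))

end Manifold

end HigherDeRham
end

noncomputable section

namespace HigherDeRham

/-! ### The homotopy operator on a coordinate domain, and Cartan's formula -/

section Contraction

variable {n : ℕ} {V : Opens (EuclideanSpace ℝ (Fin n))}

/-! Acyclicity comes from one global homotopy. On a coordinate domain, `D` is the sum of the de Rham
part `ξⁱ ∂/∂qⁱ` and the Koszul part `pᵢ ∂/∂θᵢ`. The odd field `h = θᵢ ∂/∂pᵢ` has zero graded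
commutator with the first part, and its commutator with the second is the Euler field `ε₁`. Hence
`Dh + hD = ε₁` (`deRham_contraction_add`).

The formula descends to the complex for two reasons. First, `h` does not depend on the coordinates
(`changeCoord_contraction`): the inhomogeneous term in the transformation law of `pₐ` contains no
`p`, so `h` kills it, and what remains is exactly the transformation law of `θₐ`. Second, `h` has
bidegree `(0, -1)` (`euler₁_contraction`, `euler₂_contraction_add`).

As `ε₁` is multiplication by `k` on `A^{k,·}`, a closed `f` satisfies `D(hf) = kf`
(`deRhamD_contractionD_of_closed`), and for `k ≠ 0` it is the image of `k⁻¹ hf`. No Poincaré lemma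
or partition of unity is involved; for `k = 0` the formula gives no primitive.

The operator identities all relate derivations of definite parity, so with the Leibniz rules they
need checking only on the generators `f(q)`, `p`, `ξ`, `θ`; this is the role of `Loc.gen_induction`.
-/

variable (V) in
/-- The odd vector field `θᵢ ∂/∂pᵢ`, a contracting homotopy for `D` up to the Euler field `ε₁`. -/
def contraction : Loc V →ₗ[ℝ] Loc V :=
  ∑ i, LinearMap.mulLeft ℝ (θ V i) ∘ₗ dp V i

theorem contraction_apply (x : Loc V) : contraction V x = ∑ i, θ V i * dp V i x := by
  simp [contraction, LinearMap.sum_apply]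

/-- The field `∂/∂pᵢ` is an even derivation, so the only sign arises from moving the odd coefficient
`θᵢ` past `x`. -/
theorem contraction_mul (x y : Loc V) :
    contraction V (x * y) = contraction V x * y + parity V x * contraction V y := by
  simp only [contraction_apply, Finset.sum_mul, Finset.mul_sum, ← Finset.sum_add_distrib]
  refine Finset.sum_congr rfl fun i _ => ?_
  rw [dp_mul, mul_add, ← mul_assoc, ← mul_assoc, θ_mul_comm i x, mul_assoc (parity V x)]

theorem contraction_fn (f : smoothFun V) : contraction V (fn V f) = 0 := by
  simp [contraction_apply, dp_fn]

theorem contraction_p (i : Fin n) : contraction V (p V i) = θ V i := by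
  simp [contraction_apply, dp_p]

theorem contraction_ξ (i : Fin n) : contraction V (ξ V i) = 0 := by
  simp [contraction_apply, dp_ξ]

theorem contraction_θ (i : Fin n) : contraction V (θ V i) = 0 := by
  simp [contraction_apply, dp_θ]

/-- An odd operator anticommutes with the parity involution. This sign is what makes the cross terms
cancel in Cartan's formula for a product. -/
theorem parity_contraction (x : Loc V) :
    parity V (contraction V x) = -contraction V (parity V x) := by
  induction x using Loc.gen_induction with
  | hadd x y hx hy => simp [hx, hy, add_comm]
  | hmul x y hx hy =>
    simp only [contraction_mul, parity_mul, map_add, hx, hy]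
    simp [add_comm]
  | hfn f => simp [contraction_fn, parity_fn]
  | hp i => simp [contraction_p, parity_p, parity_θ]
  | hξ i => simp [contraction_ξ, parity_ξ]
  | hθ i => simp [contraction_θ, parity_θ]

/-- The Cartan formula `[D, θᵢ ∂/∂pᵢ] = ε₁`. -/
theorem deRham_contraction_add (x : Loc V) :
    deRham V (contraction V x) + contraction V (deRham V x) = euler₁ V x := by
  induction x using Loc.gen_induction with
  | hadd x y hx hy => simp only [map_add, ← hx, ← hy]; abel
  -- Both `D` and `h` are odd, so the cross terms `parity (h x) * D y` and `h (parity x) * D y`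
  -- cancel, and likewise those with `D` and `h` exchanged. In the surviving terms `parity` is
  -- applied twice to `x`, hence disappears.
  | hmul x y hx hy =>
    simp only [contraction_mul, deRham_mul, euler₁_mul, map_add, ← hx, ← hy, parity_deRham,
      parity_contraction, parity_parity, add_mul, mul_add, neg_mul]
    abel
  -- `D f` involves only `q` and `ξ`, so `h` kills it.
  | hfn f => simp [contraction_fn, deRham_fn, euler₁_fn, contraction_mul, contraction_ξ]
  | hp i => simp [contraction_p, deRham_p, deRham_θ, euler₁_p]
  | hξ i => simp [contraction_ξ, deRham_ξ, euler₁_ξ]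
  | hθ i => simp [contraction_θ, deRham_θ, contraction_p, euler₁_θ]

/-! ### The bidegree of the homotopy operator -/

/-- The operator trades a `p` for a `θ`, and both have weight `1` for `ε₁`. -/
theorem euler₁_contraction (x : Loc V) :
    euler₁ V (contraction V x) = contraction V (euler₁ V x) := by
  induction x using Loc.gen_induction with
  | hadd x y hx hy => simp [hx, hy]
  | hmul x y hx hy =>
    simp only [contraction_mul, euler₁_mul, map_add, hx, hy, parity_euler₁]; abel
  | hfn f => simp [contraction_fn, euler₁_fn]
  | hp i => simp [contraction_p, euler₁_p, euler₁_θ]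
  | hξ i => simp [contraction_ξ, euler₁_ξ]
  | hθ i => simp [contraction_θ, euler₁_θ]

/-- For `ε₂` the weight of `p` is `1` and that of `θ` is `0`, so trading `p` for `θ` lowers the
weight by one: `[ε₂, h] = -h`. -/
theorem euler₂_contraction_add (x : Loc V) :
    euler₂ V (contraction V x) + contraction V x = contraction V (euler₂ V x) := by
  induction x using Loc.gen_induction with
  | hadd x y hx hy => simp only [map_add, ← hx, ← hy]; abel
  | hmul x y hx hy =>
    simp only [contraction_mul, euler₂_mul, map_add, ← hx, ← hy, parity_euler₂, add_mul, mul_add]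
    abel
  | hfn f => simp [contraction_fn, euler₂_fn]
  | hp i => simp [contraction_p, euler₂_p, euler₂_θ]
  | hξ i => simp [contraction_ξ, euler₂_ξ]
  | hθ i => simp [contraction_θ, euler₂_θ]

/-! ### Behaviour under substitution of coordinates -/

/-- Both sides are odd derivations along the homomorphism `subst c Ξ Θ P`, so agreement on
generators suffices; `hΞ`, `hΘ` and `hP` express it on `ξ`, `θ` and `p`. No condition on `c` appears
because functions of `q` are killed on both sides. The role of `hparity` is to let the substitution
commute with the sign in the Leibniz rule. -/
theorem subst_contraction {V' : Opens (EuclideanSpace ℝ (Fin n))}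
    (c : smoothFun V →ₐ[ℝ] smoothFun V') (Ξ Θ : Fin n → oddLinear V')
    (P : Fin n → Subalgebra.center ℝ (Loc V')) (hparity : ∀ i, parity V' (P i) = P i)
    (hΞ : ∀ i, contraction V' (Ξ i) = 0) (hΘ : ∀ i, contraction V' (Θ i) = 0)
    (hP : ∀ i, contraction V' (P i) = Θ i) (x : Loc V) :
    subst c Ξ Θ P (contraction V x) = contraction V' (subst c Ξ Θ P x) := by
  induction x using Loc.gen_induction with
  | hadd x y hx hy => simp [hx, hy]
  | hmul x y hx hy => simp [contraction_mul, hx, hy, parity_subst c Ξ Θ P hparity]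
  | hfn f => simp [contraction_fn, subst_fn]
  | hp i => simp [contraction_p, subst_p, subst_θ, hP]
  | hξ i => simp [contraction_ξ, subst_ξ, hΞ]
  | hθ i => simp [contraction_θ, subst_θ, hΘ]

end Contraction

/-! ### The global homotopy operator on the complex -/

section Manifold

variable {n : ℕ} {M : Type*} [TopologicalSpace M] [ChartedSpace (EuclideanSpace ℝ (Fin n)) M]

theorem restrict_contraction (e e' : Chart n M) (x : Loc e'.target) :
    restrict e e' (contraction _ x) = contraction _ (restrict e e' x) :=
  subst_contraction _ _ _ _ parity_p contraction_ξ contraction_θ contraction_p x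

variable [IsManifold (𝓡 n) ∞ M]

/-- The law for `pₐ` is affine in the new momenta: its linear part has the same coefficients
`∂yᵇ/∂xᵃ` as the law for `θₐ`, and its inhomogeneous part is free of `p`. Replacing `p_b` by `θ_b`
thus turns the one law into the other. -/
theorem changeCoord_contraction (e e' : Chart n M) (x : Loc e.target) :
    changeCoord e e' (contraction _ x) = contraction _ (changeCoord e e' x) := by
  refine subst_contraction _ _ _ _ (fun a => ?_) (fun a => ?_) (fun a => ?_) (fun a => ?_) x
  -- The image of `pₐ` is even: its inhomogeneous term contains the product of two odd coordinates.
  · simp [parity_mul, parity_fn, parity_p, parity_ξ, parity_θ]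
  · simp [contraction_mul, contraction_fn, contraction_ξ]
  · simp [contraction_mul, contraction_fn, contraction_θ]
  -- The Jacobian coefficients depend only on `q` and pass through unchanged, while the `ξᶜ θ_b`
  -- terms vanish.
  · simp [contraction_mul, contraction_fn, contraction_p, contraction_ξ, contraction_θ, parity_fn]

variable (n M) in
/-- The vector field `θᵢ ∂/∂pᵢ` does not depend on the coordinates, and acts on the functions
on `T*[2]T[1]M`, lowering the second degree by one. -/
def contractionD (k l : ℤ) : bidegree n M k (l + 1) →ₗ[ℝ] bidegree n M k l where
  toFun f := ⟨fun e => contraction _ (f.1 e), by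
    refine ⟨fun e e' => ?_, fun e => ⟨?_, ?_⟩⟩
    · rw [changeCoord_contraction, restrict_contraction, f.2.1 e e']
    · rw [euler₁_contraction, (f.2.2 e).1, map_smul]
    -- The weight of `f` is `l + 1`, and subtracting one copy of `h f` leaves `l`.
    · rw [eq_sub_of_add_eq (euler₂_contraction_add (f.1 e)), (f.2.2 e).2, map_smul]
      push_cast
      rw [add_smul, one_smul, add_sub_cancel_right]⟩
  map_add' f g := by ext e; simp
  map_smul' r f := by ext e; simp

/-- In Cartan's formula the term `h (D f)` drops out, and `ε₁` acts on `f` as the scalar `k`. -/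
theorem deRhamD_contractionD_of_closed {k l : ℤ} (f : bidegree n M k (l + 1))
    (hf : deRhamD n M k (l + 1) f = 0) :
    deRhamD n M k l (contractionD n M k l f) = (k : ℝ) • f := by
  ext e
  have h0 : deRham _ (f.1 e) = 0 := congrFun (congrArg Subtype.val hf) e
  have h := deRham_contraction_add (f.1 e)
  rw [h0, map_zero, add_zero, (f.2.2 e).1] at h
  exact h

end Manifold

end HigherDeRham

end

/-! ### Acyclicity -/

/-- For every `k > 0` the higher de Rham complex `(A^{k,·}, D)` of a smooth manifold is acyclic. -/
theorem mainTheorem3 {n : ℕ} {M : Type*} [TopologicalSpace M]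
    [ChartedSpace (EuclideanSpace ℝ (Fin n)) M] [IsManifold (𝓡 n) ∞ M] (k : ℤ) (hk : 0 < k) :
    (HigherDeRham.higherDeRhamComplex n M k).Acyclic := by
  intro l
  -- With the degree written as `j + 1`, the incoming differential starts at `j`, and the types of
  -- `deRhamD` and `contractionD` match without transport along an equality of degrees.
  obtain ⟨j, rfl⟩ : ∃ j, l = j + 1 := ⟨l - 1, by ring⟩
  rw [HomologicalComplex.exactAt_iff' _ j (j + 1) (j + 1 + 1) (by simp) (by simp),
    CategoryTheory.ShortComplex.moduleCat_exact_iff]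
  -- `CochainComplex.of` defines its differential for arbitrary pairs of degrees; on consecutive
  -- ones this recovers `D` itself.
  have hd (i : ℤ) : (HigherDeRham.higherDeRhamComplex n M k).d i (i + 1)
      = ModuleCat.ofHom (HigherDeRham.deRhamD n M k i) :=
    CochainComplex.of_d (fun l => ModuleCat.of ℝ (HigherDeRham.bidegree n M k l))
      (fun l => ModuleCat.ofHom (HigherDeRham.deRhamD n M k l)) i
  intro (f : HigherDeRham.bidegree n M k (j + 1)) hf
  have hf' : HigherDeRham.deRhamD n M k (j + 1) f = 0 := by
    have h := hf
    simp only [HomologicalComplex.shortComplexFunctor'_obj_g, hd] at h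
    exact h
  -- Since `D (h f) = k f`, the primitive is `h f` divided by `k`; positivity of `k` enters only
  -- through `k ≠ 0`.
  refine ⟨(k : ℝ)⁻¹ • HigherDeRham.contractionD n M k j f, ?_⟩
  simp only [HomologicalComplex.shortComplexFunctor'_obj_f, hd]
  change HigherDeRham.deRhamD n M k j _ = f
  rw [map_smul, HigherDeRham.deRhamD_contractionD_of_closed f hf',
    inv_smul_smul₀ (Int.cast_ne_zero.mpr hk.ne')]
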